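/- Let $g:\mathbb R^m\times\mathbb R^n\to\mathbb R^l$, $h=(h_1,\dots,h_{l_P}):\mathbb R^m\to\mathbb R^{l_P}$, let $C\subset\mathbb R^l$ be the union of finitely many convex polyhedra, and put $$P:=\{p\in\mathbb R^m\mid h_i(p)\le 0,\ i=1,\dots,l_P\},\qquad \Gamma(p):=\{x\in\mathbb R^n\mid g(p,x)\in C\}.$$ Let $\bar p\in\mathbb R^m$ and $\bar x\in\mathbb R^n$ satisfy $h(\bar p)=0$ and $g(\bar p,\bar x)\in C$. Assume that $g$ is twice differentiable at $(\bar p,\bar x)$ and $h$ is twice differentiable at $\bar p$; that there are neighborhoods $U_0$ of $\bar x$ and $V_0$ of $\bar p$ such that $g(p,\cdot)$ is continuously differentiable on $U_0$ for every $p\in V_0\cap P$; that $g$ and $\nabla_x g$ are continuous at $(\bar p,\bar x)$ relative to $P\times\mathbb R^n$; and that the mapping $h(\cdot)-\mathbb R^{l_P}_-$ is metrically subregular at $(\bar p,0)$, i.e. there is $\kappa'\ge 0$ with $\operatorname{dist}(p;P)\le\kappa'\operatorname{dist}(h(p);\mathbb R^{l_P}_-)$ for all $p$ near $\bar p$. For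 $\Omega\subset\mathbb R^d$ and $\bar z\in\Omega$ let $$T_\Omega(\bar z)=\{u\mid \exists\, t_k\downarrow 0,\ u_k\to u:\ \bar z+t_ku_k\in\Omega\ \forall k\},\qquad \widehat N_\Omega(\bar z)=\{v\mid \langle v,u\rangle\le 0\ \forall u\in T_\Omega(\bar z)\},$$ and, for a direction $d$, $$N_\Omega(\bar z;d)=\{v\mid \exists\, t_k\downarrow 0,\ d_k\to d,\ v_k\to v:\ \bar z+t_kd_k\in\Omega,\ v_k\in\widehat N_\Omega(\bar z+t_kd_k)\ \forall k\}.$$ Suppose that for every $w\in\mathbb R^m$ with $\nabla h(\bar p)w\le 0$ (componentwise) there is $u\in\mathbb R^n$ with $\nabla g(\bar p,\bar x)(w,u)\in T_C(g(\bar p,\bar x))$. Suppose further that for every triple $(w,u,\lambda)\in\mathbb R^m\times\mathbb R^n\times\mathbb R^l$ satisfying $$(w,u)\ne(0,0),\quad \nabla h(\bar p)w\le 0,\quad \nabla g(\bar p,\bar x)(w,u)\in T_C(g(\bar p,\bar x)),$$ $$0\ne\lambda\in N_C\big(g(\bar p,\bar x);\nabla g(\bar p,\bar x)(w,u)\big),\quad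 \nabla_xg(\bar p,\bar x)^*\lambda=0,$$ there exists $\mu\in\mathbb R^{l_P}_+$ such that $\nabla_pg(\bar p,\bar x)^*\lambda=\nabla h(\bar p)^*\mu$ and $$\big\langle\nabla^2\langle\lambda,g\rangle(\bar p,\bar x)(w,u),(w,u)\big\rangle-\big\langle\nabla^2\langle\mu,h\rangle(\bar p)w,w\big\rangle<0.$$ Then the system $g(p,x)\in C$, $p\in P$, is Robinson stable at $(\bar p,\bar x)$: there are $\kappa\ge 0$ and neighborhoods $V$ of $\bar p$ and $U$ of $\bar x$ such that $$\operatorname{dist}\big(x;\Gamma(p)\big)\le\kappa\,\operatorname{dist}\big(g(p,x);C\big)\quad\text{for all }p\in V\cap P,\ x\in U,$$ where the distance to the empty set is $+\infty$ (so that $\Gamma(p)\ne\emptyset$ for these $p$). -/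

import Mathlib

open Set Filter Topology
open scoped NNReal ENNReal

namespace RobinsonStability

/-- `ℝᵈ` with its Euclidean norm and inner product. -/
abbrev Euc (d : ℕ) : Type := EuclideanSpace ℝ (Fin d)

section Cones

variable {E : Type*} [NormedAddCommGroup E] [InnerProductSpace ℝ E]

/-- The contingent (Bouligand–Severi) cone: all `u` for which there are `t k ↓ 0` and `u k → u`
with `z + t k • u k ∈ Ω` for all `k`. -/
def contingentCone (Ω : Set E) (z : E) : Set E :=
  {u | ∃ (t : ℕ → ℝ) (u' : ℕ → E), (∀ k, 0 < t k) ∧ Tendsto t atTop (𝓝 0) ∧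
    Tendsto u' atTop (𝓝 u) ∧ ∀ k, z + t k • u' k ∈ Ω}

/-- The (Fréchet) regular normal cone, the polar of the contingent cone. -/
def regularNormalCone (Ω : Set E) (z : E) : Set E :=
  {v | ∀ u ∈ contingentCone Ω z, inner ℝ v u ≤ 0}

/-- The limiting normal cone to `Ω` at `z` in direction `w`. -/
def directionalNormalCone (Ω : Set E) (z w : E) : Set E :=
  {v | ∃ (t : ℕ → ℝ) (w' v' : ℕ → E), (∀ k, 0 < t k) ∧ Tendsto t atTop (𝓝 0) ∧
    Tendsto w' atTop (𝓝 w) ∧ Tendsto v' atTop (𝓝 v) ∧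
    ∀ k, z + t k • w' k ∈ Ω ∧ v' k ∈ regularNormalCone Ω (z + t k • w' k)}

/-- A convex polyhedron: the intersection of finitely many closed half-spaces. -/
def IsConvexPolyhedron (S : Set E) : Prop :=
  ∃ (r : ℕ) (a : Fin r → E) (b : Fin r → ℝ), S = {x | ∀ j, inner ℝ (a j) x ≤ b j}

/-- The union of finitely many convex polyhedra. -/
def IsFiniteUnionOfConvexPolyhedra (S : Set E) : Prop :=
  ∃ (N : ℕ) (Q : Fin N → Set E), (∀ i, IsConvexPolyhedron (Q i)) ∧ S = ⋃ i, Q i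

end Cones

section Differentiability

variable {E F : Type*} [NormedAddCommGroup E] [NormedSpace ℝ E]
  [NormedAddCommGroup F] [NormedSpace ℝ F]

/-- `f` is twice (Fréchet) differentiable at `z`: it is differentiable near `z` and its derivative
is differentiable at `z`. -/
def TwiceDifferentiableAt (f : E → F) (z : E) : Prop :=
  (∀ᶠ y in 𝓝 z, DifferentiableAt ℝ f y) ∧ DifferentiableAt ℝ (fderiv ℝ f) z

/-- The quadratic form `⟨∇²φ(z) d, d⟩` of the Hessian of a scalar function `φ`. -/
noncomputable def hessianForm (φ : E → ℝ) (z d : E) : ℝ :=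
  fderiv ℝ (fderiv ℝ φ) z d d

end Differentiability

section Subregularity

/-- The set-valued mapping `z ↦ f(z) - Q`. -/
def constraintMapping {Z Y : Type*} [Sub Y] (f : Z → Y) (Q : Set Y) : Z → Set Y :=
  fun z => {y | ∃ q ∈ Q, y = f z - q}

/-- Metric subregularity of the set-valued mapping `F` at the point `(z, y)` of its graph:
`dist(z'; F⁻¹(y)) ≤ κ dist(y; F(z'))` for all `z'` close to `z`. Distances to the empty set
are infinite. -/
def MetricallySubregularAt {Z Y : Type*} [PseudoEMetricSpace Z] [PseudoEMetricSpace Y]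
    (F : Z → Set Y) (z : Z) (y : Y) : Prop :=
  y ∈ F z ∧ ∃ κ : ℝ≥0, ∀ᶠ z' in 𝓝 z,
    Metric.infEDist z' {ζ | y ∈ F ζ} ≤ (κ : ℝ≥0∞) * Metric.infEDist y (F z')

/-- The nonpositive orthant of `ℝᵈ`. -/
def nonposOrthant (d : ℕ) : Set (Euc d) := {y | ∀ i, y i ≤ 0}

end Subregularity

section Systems

variable {m n l : ℕ}

/-- The solution map `Γ(p) = {x | g(p, x) ∈ C}`. -/
def solutionMap (g : Euc m × Euc n → Euc l) (C : Set (Euc l)) (p : Euc m) : Set (Euc n) :=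
  {x | g (p, x) ∈ C}

/-- Robinson stability at `(pbar, xbar)` of the system `g(p, x) ∈ C`, `x ∈ ℝⁿ`, `p ∈ P`: the
estimate `dist(x; Γ(p)) ≤ κ dist(g(p, x); C)` holds for some `κ ≥ 0`, all `x` near `xbar` and all
`p ∈ P` near `pbar`. Distances to the empty set are infinite, so that `Γ(p) ≠ ∅` for these `p`
(if `C ≠ ∅`). -/
def RobinsonStableAt (g : Euc m × Euc n → Euc l) (C : Set (Euc l)) (P : Set (Euc m))
    (pbar : Euc m) (xbar : Euc n) : Prop :=
  ∃ κ : ℝ≥0, ∃ V ∈ 𝓝 pbar, ∃ U ∈ 𝓝 xbar, ∀ p ∈ V ∩ P, ∀ x ∈ U,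
    Metric.infEDist x (solutionMap g C p) ≤ (κ : ℝ≥0∞) * Metric.infEDist (g (p, x)) C

/-- The partial derivative `∇ₓ g(p, x)`. -/
noncomputable def partialX (g : Euc m × Euc n → Euc l) (p : Euc m) (x : Euc n) :
    Euc n →L[ℝ] Euc l :=
  fderiv ℝ (fun ξ => g (p, ξ)) x

/-- The partial derivative `∇ₚ g(p, x)`. -/
noncomputable def partialP (g : Euc m × Euc n → Euc l) (p : Euc m) (x : Euc n) :
    Euc m →L[ℝ] Euc l :=
  fderiv ℝ (fun π => g (π, x)) p

/-- Smoothness of `g` in the decision variable: for all `p ∈ P` near `pbar`, the mapping `g(p, ·)`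
is continuously differentiable on a fixed neighborhood of `xbar`, and `g` and `∇ₓ g` are
continuous at `(pbar, xbar)` relative to `P × ℝⁿ`. -/
def SmoothInDecisionAt (g : Euc m × Euc n → Euc l) (P : Set (Euc m))
    (pbar : Euc m) (xbar : Euc n) : Prop :=
  (∃ U : Set (Euc n), IsOpen U ∧ xbar ∈ U ∧ ∃ V ∈ 𝓝 pbar, ∀ p ∈ V ∩ P,
    ContDiffOn ℝ 1 (fun x => g (p, x)) U) ∧
  ContinuousWithinAt g (P ×ˢ univ) (pbar, xbar) ∧
  ContinuousWithinAt (fun z : Euc m × Euc n => partialX g z.1 z.2) (P ×ˢ univ) (pbar, xbar)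

end Systems

end RobinsonStability

/-! One mechanism, used by contradiction, drives the whole proof. Let `(p k, x k)` approach the
reference point along a direction `(w, u) ≠ 0` at scale `t k`, with `h (p k) ≤ 0` and residual at
most `s k * (ρ k * t k)`, where `s, ρ → 0`. If no solution for `p k` lies within `ρ k * t k` of `x
k`, minimizing the residual plus `s k` times the distance to `x k` over that ball produces a unit
regular normal `v k` to `C` that almost annihilates the `x`-derivative of `g`
(`exists_approximate_multiplier`).

A limit `λ` of these normals is a multiplier for `(w, u)`; let `μ` be its compensating multiplier.
Polyhedrality makes `λ` exactly orthogonal, infinitely often, to the displacement of the projected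
points (`IsFiniteUnionOfConvexPolyhedra.frequently_inner_eq_zero`). Hence `⟨λ, g⟩` has a positive
increment while `⟨μ, h⟩ ≤ 0`. The first-order terms cancel, so the second-order form is nonnegative,
a contradiction (`false_of_approximate_multipliers`).

The resulting `frequently_exists_solution_near` is used twice: along tangent directions it gives
solutions `y` with `‖y - xbar‖ = O(‖p - pbar‖)`; these a priori solutions then make a putative
violation of the Robinson estimate have small enough residual for a second application. -/

namespace RobinsonStability

/-! ### Second-order expansions at a point of twice differentiability -/

section Taylor

variable {E : Type*} [NormedAddCommGroup E] [NormedSpace ℝ E]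

/-- Second-order Taylor expansion with Peano remainder. -/
theorem TwiceDifferentiableAt.taylor_bound {f : E → ℝ} {z : E} (hf : TwiceDifferentiableAt f z)
    {ε : ℝ} (hε : 0 < ε) :
    ∀ᶠ d in 𝓝 (0 : E),
      |f (z + d) - f z - fderiv ℝ f z d - 2⁻¹ * hessianForm f z d| ≤ ε * ‖d‖ ^ 2 := by
  have h1 := hf.1
  have h2 := (hasFDerivAt_iff_isLittleO_nhds_zero.1 hf.2.hasFDerivAt).def hε
  have h1' : ∀ᶠ d in 𝓝 (0 : E), DifferentiableAt ℝ f (z + d) := by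
    have : Tendsto (fun d : E => z + d) (𝓝 0) (𝓝 z) := by
      simpa using (tendsto_const_nhds (x := z)).add (tendsto_id (x := 𝓝 (0 : E)))
    exact this.eventually h1
  obtain ⟨r, hr, hball⟩ := Metric.eventually_nhds_iff_ball.1 (h1'.and h2)
  refine Metric.eventually_nhds_iff_ball.2 ⟨r, hr, fun d hd => ?_⟩
  set B := fderiv ℝ (fderiv ℝ f) z with hB
  -- Up to the constant `f z`, this is the Taylor remainder on the segment. Its derivative is the
  -- linearization error of the gradient applied to `d`, so the mean value inequality suffices and
  -- no second derivative away from `z` is needed.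
  let R : ℝ → ℝ := fun τ => f (z + τ • d) - τ * fderiv ℝ f z d - 2⁻¹ * τ ^ 2 * B d d
  have hmem : ∀ τ ∈ Icc (0 : ℝ) 1, τ • d ∈ Metric.ball (0 : E) r := by
    intro τ hτ
    rw [mem_ball_zero_iff] at hd ⊢
    rw [norm_smul, Real.norm_eq_abs, abs_of_nonneg hτ.1]
    nlinarith [norm_nonneg d, hτ.1, hτ.2]
  have hderiv : ∀ τ ∈ Icc (0 : ℝ) 1, HasDerivAt R
      (fderiv ℝ f (z + τ • d) d - fderiv ℝ f z d - τ * B d d) τ := by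
    intro τ hτ
    have hl : HasDerivAt (fun τ : ℝ => z + τ • d) d τ := by
      simpa using ((hasDerivAt_id τ).smul_const d).const_add z
    have ha := ((hball _ (hmem τ hτ)).1.hasFDerivAt.comp_hasDerivAt τ hl)
    have hb := ((hasDerivAt_id τ).mul_const (fderiv ℝ f z d))
    have hc := (((hasDerivAt_pow 2 τ).const_mul (2⁻¹ : ℝ)).mul_const (B d d))
    refine ((ha.sub hb).sub hc).congr_deriv ?_
    norm_num
    left; ring
  have hbound : ∀ τ ∈ Ico (0 : ℝ) 1,
      ‖fderiv ℝ f (z + τ • d) d - fderiv ℝ f z d - τ * B d d‖ ≤ ε * ‖d‖ ^ 2 := by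
    intro τ hτ
    have hτ' := Ico_subset_Icc_self hτ
    have h3 := (hball _ (hmem τ hτ')).2
    have h4 : fderiv ℝ f (z + τ • d) d - fderiv ℝ f z d - τ * B d d
        = (fderiv ℝ f (z + τ • d) - fderiv ℝ f z - B (τ • d)) d := by
      simp
    rw [h4]
    refine (ContinuousLinearMap.le_opNorm _ _).trans ?_
    have h5 : ‖τ • d‖ ≤ ‖d‖ := by
      rw [norm_smul, Real.norm_eq_abs, abs_of_nonneg hτ.1]
      nlinarith [norm_nonneg d, hτ.2]
    calc _ ≤ (ε * ‖τ • d‖) * ‖d‖ := by gcongr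
      _ ≤ (ε * ‖d‖) * ‖d‖ := by gcongr
      _ = _ := by ring
  have hmv := norm_image_sub_le_of_norm_deriv_le_segment'
    (fun τ hτ => (hderiv τ hτ).hasDerivWithinAt) hbound 1 (by simp)
  have h6 : R 1 - R 0 = f (z + d) - f z - fderiv ℝ f z d - 2⁻¹ * hessianForm f z d := by
    simp [R, hessianForm, hB]; ring
  rw [h6, Real.norm_eq_abs] at hmv
  simpa using hmv

/-- Second-order Taylor expansion along a sequence `z + t k • d k`. -/
theorem TwiceDifferentiableAt.tendsto_taylor {f : E → ℝ} {z : E} (hf : TwiceDifferentiableAt f z)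
    {t : ℕ → ℝ} {d : ℕ → E} {d₀ : E} (htpos : ∀ k, 0 < t k) (ht : Tendsto t atTop (𝓝 0))
    (hd : Tendsto d atTop (𝓝 d₀)) :
    Tendsto (fun k => (f (z + t k • d k) - f z - fderiv ℝ f z (t k • d k)) / t k ^ 2) atTop
      (𝓝 (2⁻¹ * hessianForm f z d₀)) := by
  have hq : Tendsto (fun k => 2⁻¹ * hessianForm f z (d k)) atTop
      (𝓝 (2⁻¹ * hessianForm f z d₀)) := by
    have hc : Continuous fun d : E => 2⁻¹ * hessianForm f z d := by
      unfold hessianForm; fun_prop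
    exact (hc.tendsto d₀).comp hd
  have htd : Tendsto (fun k => t k • d k) atTop (𝓝 0) := by simpa using ht.smul hd
  suffices hdiff : Tendsto (fun k => (f (z + t k • d k) - f z - fderiv ℝ f z (t k • d k)) / t k ^ 2
      - 2⁻¹ * hessianForm f z (d k)) atTop (𝓝 0) by
    simpa using hdiff.add hq
  rw [Metric.tendsto_nhds]
  intro ε hε
  set M := ‖d₀‖ + 1
  have hM : 0 < M := by positivity
  have hdM : ∀ᶠ k in atTop, ‖d k‖ < M := hd.norm.eventually_lt_const (by simp [M])
  -- With `‖d k‖ < M`, this tolerance makes the remainder at most `ε / 2 * t k ^ 2`.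
  filter_upwards [htd.eventually (hf.taylor_bound (ε := ε / (2 * M ^ 2)) (by positivity)), hdM]
    with k h1 h2
  have ht0 := htpos k
  have h3 : (f (z + t k • d k) - f z - fderiv ℝ f z (t k • d k)) / t k ^ 2
      - 2⁻¹ * hessianForm f z (d k) = (f (z + t k • d k) - f z - fderiv ℝ f z (t k • d k)
        - 2⁻¹ * hessianForm f z (t k • d k)) / t k ^ 2 := by
    have : hessianForm f z (t k • d k) = t k ^ 2 * hessianForm f z (d k) := by
      simp [hessianForm]; ring
    rw [this]; field_simp
  rw [Real.dist_eq, sub_zero, h3, abs_div, abs_of_pos (by positivity : 0 < t k ^ 2),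
    div_lt_iff₀ (by positivity)]
  refine h1.trans_lt ?_
  rw [norm_smul, Real.norm_eq_abs, abs_of_pos ht0, mul_pow]
  have h4 : ‖d k‖ ^ 2 ≤ M ^ 2 := by gcongr
  calc _ ≤ ε / (2 * M ^ 2) * (t k ^ 2 * M ^ 2) := by gcongr
    _ = ε / 2 * t k ^ 2 := by field_simp
    _ < _ := by gcongr; linarith

theorem tendsto_difference_quotient {F : Type*} [NormedAddCommGroup F] [NormedSpace ℝ F]
    {f : E → F} {f' : E →L[ℝ] F} {z : E} (hf : HasFDerivAt f f' z)
    {t : ℕ → ℝ} {d : ℕ → E} {d₀ : E} (htpos : ∀ k, 0 < t k) (ht : Tendsto t atTop (𝓝 0))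
    (hd : Tendsto d atTop (𝓝 d₀)) :
    Tendsto (fun k => (t k)⁻¹ • (f (z + t k • d k) - f z)) atTop (𝓝 (f' d₀)) := by
  refine hf.hasFDerivWithinAt (s := univ).lim ?_ (.of_forall fun _ => mem_univ _) ?_
  · simpa using ht.smul hd
  · refine hd.congr fun k => ?_
    rw [smul_smul, inv_mul_cancel₀ (htpos k).ne', one_smul]

end Taylor

/-! ### Scalarized maps -/

section Scalarization

variable {E : Type*} [NormedAddCommGroup E] [NormedSpace ℝ E]
  {F : Type*} [NormedAddCommGroup F] [InnerProductSpace ℝ F]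

theorem fderiv_inner_left_const {f : E → F} {y : E} (hf : DifferentiableAt ℝ f y) (v : F) :
    fderiv ℝ (fun x => inner ℝ v (f x)) y = (innerSL ℝ v).comp (fderiv ℝ f y) :=
  ((innerSL ℝ v).hasFDerivAt.comp y hf.hasFDerivAt).fderiv

theorem TwiceDifferentiableAt.inner_left_const {f : E → F} {z : E}
    (hf : TwiceDifferentiableAt f z) (v : F) :
    TwiceDifferentiableAt (fun x => inner ℝ v (f x)) z := by
  refine ⟨hf.1.mono fun y hy => (innerSL ℝ v).differentiableAt.comp y hy, ?_⟩
  have h1 : DifferentiableAt ℝ (fun y => (innerSL ℝ v).comp (fderiv ℝ f y)) z :=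
    (differentiableAt_const _).clm_comp hf.2
  exact h1.congr_of_eventuallyEq (hf.1.mono fun y hy => fderiv_inner_left_const hy v)

end Scalarization

/-! ### Tangents and normals to finite unions of polyhedra -/

section Normals

variable {E : Type*} [NormedAddCommGroup E] [InnerProductSpace ℝ E]

/-- The residual of a nearest-point projection is a regular normal. -/
theorem sub_mem_regularNormalCone {C : Set E} {y c : E}
    (hmin : ∀ c' ∈ C, ‖y - c‖ ≤ ‖y - c'‖) : y - c ∈ regularNormalCone C c := by
  rintro u ⟨t, u', htpos, ht, hu', hC⟩
  -- Expand the square in the minimality inequality and divide by `2 * t k`; the bound vanishes in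
  -- the limit.
  have h1 : ∀ k, inner ℝ (y - c) (u' k) ≤ t k / 2 * ‖u' k‖ ^ 2 := by
    intro k
    have h2 := hmin _ (hC k)
    have h3 : ‖y - c‖ ^ 2 ≤ ‖(y - c) - t k • u' k‖ ^ 2 := by
      rw [sub_sub]; gcongr
    rw [norm_sub_sq_real (y - c), inner_smul_right, norm_smul, mul_pow, Real.norm_eq_abs, sq_abs] at h3
    have := htpos k
    have h4 : t k * inner ℝ (y - c) (u' k) ≤ t k * (t k / 2 * ‖u' k‖ ^ 2) := by nlinarith
    exact le_of_mul_le_mul_left h4 this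
  have h5 : Tendsto (fun k => t k / 2 * ‖u' k‖ ^ 2) atTop (𝓝 0) := by
    simpa using (ht.div_const 2).mul (hu'.norm.pow 2)
  exact le_of_tendsto_of_tendsto' (tendsto_const_nhds.inner hu') h5 h1

theorem smul_mem_regularNormalCone {C : Set E} {c v : E} (hv : v ∈ regularNormalCone C c)
    {a : ℝ} (ha : 0 ≤ a) : a • v ∈ regularNormalCone C c := fun u hu => by
  rw [real_inner_smul_left]
  exact mul_nonpos_of_nonneg_of_nonpos ha (hv u hu)

/-- Inactive constraints stay strict for small `τ` by continuity, active ones do not increase along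
`d`, and there are finitely many of them. -/
theorem eventually_mem_polyhedron_of_active {r : ℕ} {a : Fin r → E} {b : Fin r → ℝ} {c d : E}
    (hc : ∀ j, inner ℝ (a j) c ≤ b j)
    (hd : ∀ j, inner ℝ (a j) c = b j → inner ℝ (a j) d ≤ 0) :
    ∀ᶠ τ in 𝓝[>] (0 : ℝ), c + τ • d ∈ {x | ∀ j, inner ℝ (a j) x ≤ b j} := by
  refine eventually_all.2 fun j => ?_
  rcases (hc j).lt_or_eq with hlt | heq
  · have hcont : Tendsto (fun τ : ℝ => inner ℝ (a j) (c + τ • d)) (𝓝[>] 0)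
        (𝓝 (inner ℝ (a j) c)) := by
      have : Continuous fun τ : ℝ => inner ℝ (a j) (c + τ • d) := by fun_prop
      simpa using (this.tendsto 0).mono_left nhdsWithin_le_nhds
    exact (hcont.eventually_lt_const hlt).mono fun _ h => h.le
  · filter_upwards [self_mem_nhdsWithin] with τ hτ
    rw [inner_add_right, inner_smul_right, heq]
    nlinarith [hd j heq, mem_Ioi.1 hτ]

/-- A direction compatible with the active constraints of a polyhedron is tangent. -/
theorem mem_contingentCone_of_active {C : Set E} {r : ℕ} {a : Fin r → E} {b : Fin r → ℝ}
    (hQ : {x | ∀ j, inner ℝ (a j) x ≤ b j} ⊆ C) {c d : E} (hc : ∀ j, inner ℝ (a j) c ≤ b j)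
    (hd : ∀ j, inner ℝ (a j) c = b j → inner ℝ (a j) d ≤ 0) : d ∈ contingentCone C c := by
  obtain ⟨ε, hε, hsub⟩ := mem_nhdsGT_iff_exists_Ioc_subset.1
    (eventually_mem_polyhedron_of_active hc hd)
  have hε' : 0 < ε := hε
  refine ⟨fun k => ε / (k + 1), fun _ => d, fun k => by positivity, ?_, tendsto_const_nhds,
    fun k => hQ (hsub ⟨by positivity, ?_⟩)⟩
  · have := (tendsto_one_div_add_atTop_nhds_zero_nat (𝕜 := ℝ)).const_mul ε
    simpa [div_eq_mul_inv] using this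
  · exact div_le_self hε'.le (by simp)

/-- Tangent directions of a union of finitely many polyhedra are feasible directions. -/
theorem IsFiniteUnionOfConvexPolyhedra.eventually_mem_of_mem_contingentCone {C : Set E}
    (hC : IsFiniteUnionOfConvexPolyhedra C) {c d : E} (hd : d ∈ contingentCone C c) :
    ∀ᶠ τ in 𝓝[>] (0 : ℝ), c + τ • d ∈ C := by
  obtain ⟨N, Q, hQ, rfl⟩ := hC
  obtain ⟨t, d', htpos, ht, hd', hmem⟩ := hd
  choose i hi using fun k => mem_iUnion.1 (hmem k)
  -- One polyhedron contains infinitely many of the points. It is closed, so it contains `c`, and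
  -- `d` inherits its active inequalities.
  obtain ⟨i₀, hinf⟩ := Finite.exists_infinite_fiber i
  have hfreq : ∃ᶠ k in atTop, i k = i₀ := by
    rw [Nat.frequently_atTop_iff_infinite]
    exact Set.infinite_coe_iff.1 hinf
  obtain ⟨r, a, b, hab⟩ := hQ i₀
  have hfreq' : ∃ᶠ k in atTop, ∀ j, inner ℝ (a j) (c + t k • d' k) ≤ b j :=
    hfreq.mono fun k hk => by
      have h1 := hi k
      rw [hk, hab] at h1
      exact h1
  have hcd : Tendsto (fun k => c + t k • d' k) atTop (𝓝 c) := by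
    simpa using (ht.smul hd').const_add c
  have hc : ∀ j, inner ℝ (a j) c ≤ b j := fun j =>
    le_of_tendsto_of_frequently (tendsto_const_nhds.inner hcd) (hfreq'.mono fun k hk => hk j)
  refine (eventually_mem_polyhedron_of_active hc fun j hj => ?_).mono fun τ hτ =>
    mem_iUnion.2 ⟨i₀, by rw [hab]; exact hτ⟩
  refine le_of_tendsto_of_frequently (tendsto_const_nhds.inner hd') (hfreq'.mono fun k hk => ?_)
  have h1 := hk j
  rw [inner_add_right, inner_smul_right, hj] at h1
  nlinarith [htpos k]

/-- For a union of finitely many polyhedra, a limit of regular normals at points converging to `c₀`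
is infinitely often orthogonal to the displacement from `c₀`. -/
theorem IsFiniteUnionOfConvexPolyhedra.frequently_inner_eq_zero {C : Set E}
    (hC : IsFiniteUnionOfConvexPolyhedra C) {c v : ℕ → E} {c₀ v₀ : E} (hcC : ∀ k, c k ∈ C)
    (hc : Tendsto c atTop (𝓝 c₀)) (hv : Tendsto v atTop (𝓝 v₀))
    (hvN : ∀ k, v k ∈ regularNormalCone C (c k)) :
    ∃ᶠ k in atTop, inner ℝ v₀ (c k - c₀) = 0 := by
  classical
  obtain ⟨N, Q, hQ, rfl⟩ := hC
  choose r a b hab using hQ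
  have hcQ : ∀ k, ∃ i, ∀ j, inner ℝ (a i j) (c k) ≤ b i j := fun k => by
    obtain ⟨i, hi⟩ := mem_iUnion.1 (hcC k)
    exact ⟨i, by rw [hab i] at hi; exact hi⟩
  choose i hi using hcQ
  -- Only finitely many pairs (polyhedron, active set) exist, so one pair recurs along a subsequence
  -- `θ`.
  let key : ℕ → Σ i : Fin N, Finset (Fin (r i)) := fun k =>
    ⟨i k, Finset.univ.filter fun j => inner ℝ (a (i k) j) (c k) = b (i k) j⟩
  obtain ⟨⟨i₀, J⟩, hinf⟩ := Finite.exists_infinite_fiber key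
  have hfreq : ∃ᶠ k in atTop, key k = ⟨i₀, J⟩ := by
    rw [Nat.frequently_atTop_iff_infinite]
    exact Set.infinite_coe_iff.1 hinf
  obtain ⟨θ, hθ, hkey⟩ := extraction_of_frequently_atTop hfreq
  have hle : ∀ k j, inner ℝ (a i₀ j) (c (θ k)) ≤ b i₀ j := fun k => by
    have h1 := hi (θ k)
    have h2 : i (θ k) = i₀ := congrArg Sigma.fst (hkey k)
    rwa [h2] at h1
  have hact : ∀ k j, inner ℝ (a i₀ j) (c (θ k)) = b i₀ j ↔ j ∈ J := fun k j => by
    have h1 : (⟨i₀, Finset.univ.filter fun j => inner ℝ (a i₀ j) (c (θ k)) = b i₀ j⟩ :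
        Σ i : Fin N, Finset (Fin (r i))) = ⟨i₀, J⟩ := by
      have h2 : i (θ k) = i₀ := congrArg Sigma.fst (hkey k)
      rw [← hkey k]
      simp only [key]
      rw [h2]
    rw [← eq_of_heq (Sigma.mk.inj h1).2]
    simp
  have hJ : ∀ j ∈ J, inner ℝ (a i₀ j) c₀ = b i₀ j := fun j hj => by
    have h1 : Tendsto (fun k => inner ℝ (a i₀ j) (c (θ k))) atTop (𝓝 (inner ℝ (a i₀ j) c₀)) :=
      tendsto_const_nhds.inner (hc.comp hθ.tendsto_atTop)
    refine tendsto_nhds_unique h1 (tendsto_const_nhds.congr fun k => ?_)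
    exact ((hact k j).2 hj).symm
  have hsub : {x | ∀ j, inner ℝ (a i₀ j) x ≤ b i₀ j} ⊆ ⋃ i, Q i := by
    rw [← hab i₀]; exact subset_iUnion Q i₀
  -- The constraints active at `c (θ k)` are active at `c (θ q)` and at `c₀`, so both signs of `c (θ
  -- q) - c₀` are tangent at `c (θ k)`. Fixing `q` and letting `k → ∞` then gives exact
  -- orthogonality to `v₀`.
  have horth : ∀ k q, inner ℝ (v (θ k)) (c (θ q) - c₀) = 0 := fun k q => by
    have hzero : ∀ j, inner ℝ (a i₀ j) (c (θ k)) = b i₀ j →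
        inner ℝ (a i₀ j) (c (θ q) - c₀) = 0 := fun j hj => by
      have hj' := (hact k j).1 hj
      rw [inner_sub_right, (hact q j).2 hj', hJ j hj', sub_self]
    have h1 := hvN (θ k) _ (mem_contingentCone_of_active hsub (hle k)
      (d := c (θ q) - c₀) fun j hj => (hzero j hj).le)
    have h2 := hvN (θ k) _ (mem_contingentCone_of_active hsub (hle k)
      (d := -(c (θ q) - c₀)) fun j hj => by rw [inner_neg_right, hzero j hj, neg_zero])
    rw [inner_neg_right] at h2
    linarith
  have horth₀ : ∀ q, inner ℝ v₀ (c (θ q) - c₀) = 0 := fun q => by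
    refine tendsto_nhds_unique ((hv.comp hθ.tendsto_atTop).inner
      (tendsto_const_nhds (x := c (θ q) - c₀))) ?_
    exact tendsto_const_nhds.congr fun k => (horth k q).symm
  exact hθ.tendsto_atTop.frequently (Frequently.of_forall horth₀)

theorem IsFiniteUnionOfConvexPolyhedra.isClosed {C : Set E}
    (hC : IsFiniteUnionOfConvexPolyhedra C) : IsClosed C := by
  obtain ⟨N, Q, hQ, rfl⟩ := hC
  refine isClosed_iUnion_of_finite fun i => ?_
  obtain ⟨r, a, b, h⟩ := hQ i
  rw [h, ofPred_forall]
  exact isClosed_iInter fun j => isClosed_le (by fun_prop) continuous_const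

end Normals

/-! ### Approximate multipliers from penalized minimization -/

/-- A perturbed minimizer of the residual `dist(F x; C)` over a closed ball produces an approximate
multiplier, unless the ball contains a solution of `F x ∈ C`. -/
theorem exists_approximate_multiplier {n l : ℕ} {F : Euc n → Euc l} {C : Set (Euc l)}
    (hCcl : IsClosed C) (hCne : C.Nonempty) {x₀ : Euc n} {r s : ℝ} (hr : 0 ≤ r) (hs : 0 ≤ s)
    (hF : ∀ x ∈ Metric.closedBall x₀ r, DifferentiableAt ℝ F x)
    (hsmall : Metric.infDist (F x₀) C ≤ s * r)
    (hno : ∀ x ∈ Metric.closedBall x₀ r, F x ∉ C) :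
    ∃ (x : Euc n) (v : Euc l) (δ : ℝ), x ∈ Metric.closedBall x₀ r ∧ ‖v‖ = 1 ∧ 0 < δ ∧ δ ≤ s * r ∧
      F x - δ • v ∈ C ∧ v ∈ regularNormalCone C (F x - δ • v) ∧
      ∀ d, -(s * ‖d‖) ≤ inner ℝ v (fderiv ℝ F x d) := by
  have hcont : ContinuousOn (fun x => Metric.infDist (F x) C + s * ‖x - x₀‖)
      (Metric.closedBall x₀ r) := by
    refine ContinuousOn.add ?_ (by fun_prop)
    exact (Metric.continuous_infDist_pt C).comp_continuousOn
      fun x hx => (hF x hx).continuousAt.continuousWithinAt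
  obtain ⟨x, hx, hmin⟩ := (isCompact_closedBall x₀ r).exists_isMinOn
    ⟨x₀, Metric.mem_closedBall_self hr⟩ hcont
  have hmin' : ∀ x' ∈ Metric.closedBall x₀ r,
      Metric.infDist (F x) C + s * ‖x - x₀‖ ≤ Metric.infDist (F x') C + s * ‖x' - x₀‖ :=
    fun x' hx' => hmin hx'
  have h0 := hmin' x₀ (Metric.mem_closedBall_self hr)
  rw [sub_self, norm_zero, mul_zero, add_zero] at h0
  have hpos : 0 < Metric.infDist (F x) C :=
    (hCcl.notMem_iff_infDist_pos hCne).1 (hno x hx)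
  have hxr : ‖x - x₀‖ < r := by
    have hle : ‖x - x₀‖ ≤ r := mem_closedBall_iff_norm.1 hx
    -- On the boundary the penalty alone would be `s * r`, leaving no room for a positive residual.
    refine lt_of_le_of_ne hle fun heq => ?_
    rw [heq] at h0
    linarith
  obtain ⟨c, hcC, hc⟩ := hCcl.exists_infDist_eq_dist hCne (F x)
  rw [dist_eq_norm] at hc
  set δ := Metric.infDist (F x) C with hδ
  have hv : δ • (δ⁻¹ • (F x - c)) = F x - c := by rw [smul_smul, mul_inv_cancel₀ hpos.ne', one_smul]
  have hc' : F x - δ • (δ⁻¹ • (F x - c)) = c := by rw [hv, sub_sub_cancel]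
  refine ⟨x, δ⁻¹ • (F x - c), δ, hx, ?_, hpos, ?_, by rwa [hc'], ?_, fun d => ?_⟩
  · rw [norm_smul, ← hc, norm_inv, Real.norm_eq_abs, abs_of_pos hpos, inv_mul_cancel₀ hpos.ne']
  · nlinarith [norm_nonneg (x - x₀)]
  · rw [hc']
    refine smul_mem_regularNormalCone (sub_mem_regularNormalCone fun c' hc'C => ?_)
      (inv_nonneg.2 hpos.le)
    rw [← hc, ← dist_eq_norm]
    exact Metric.infDist_le_dist_of_mem hc'C
  · have hl : HasDerivAt (fun τ : ℝ => x + τ • d) d 0 := by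
      simpa using ((hasDerivAt_id (0 : ℝ)).smul_const d).const_add x
    have hFd : HasDerivAt (fun τ : ℝ => F (x + τ • d) - c) (fderiv ℝ F x d) 0 := by
      have h1 : HasFDerivAt F (fderiv ℝ F x) (x + (0 : ℝ) • d) := by
        simpa using (hF x hx).hasFDerivAt
      exact (h1.comp_hasDerivAt (0 : ℝ) hl).sub_const c
    have hsq := hFd.norm_sq
    -- The distance to the fixed projection `c` majorizes the residual and equals it at `τ = 0`, so
    -- it inherits the minimality bound; squaring it makes it differentiable.
    have hnear : ∀ᶠ τ in 𝓝[>] (0 : ℝ),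
        -(s * ‖d‖) * (‖F (x + τ • d) - c‖ + δ) ≤
          τ⁻¹ • (‖F (x + τ • d) - c‖ ^ 2 - ‖F (x + (0 : ℝ) • d) - c‖ ^ 2) := by
      have hball : ∀ᶠ τ in 𝓝[>] (0 : ℝ), x + τ • d ∈ Metric.closedBall x₀ r := by
        have h1 : Tendsto (fun τ : ℝ => x + τ • d) (𝓝[>] 0) (𝓝 x) := by
          simpa using hl.continuousAt.tendsto.mono_left nhdsWithin_le_nhds
        exact h1.eventually (Metric.closedBall_mem_nhds_of_mem (mem_ball_iff_norm.2 hxr))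
      filter_upwards [hball, self_mem_nhdsWithin] with τ hτ hτ0
      have hτ0 : 0 < τ := hτ0
      have h1 := hmin' _ hτ
      have h2 : Metric.infDist (F (x + τ • d)) C ≤ ‖F (x + τ • d) - c‖ := by
        rw [← dist_eq_norm]; exact Metric.infDist_le_dist_of_mem hcC
      have h3 : ‖x + τ • d - x₀‖ ≤ ‖x - x₀‖ + τ * ‖d‖ := by
        rw [add_sub_right_comm]
        refine (norm_add_le _ _).trans_eq ?_
        rw [norm_smul, Real.norm_eq_abs, abs_of_pos hτ0]
      have h4 : -(s * ‖d‖) * τ ≤ ‖F (x + τ • d) - c‖ - δ := by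
        nlinarith [mul_le_mul_of_nonneg_left h3 hs]
      rw [zero_smul, add_zero, ← hc, smul_eq_mul, ← div_eq_inv_mul, le_div_iff₀ hτ0]
      nlinarith [mul_le_mul_of_nonneg_right h4
        (add_nonneg (norm_nonneg (F (x + τ • d) - c)) hpos.le)]
    have hlim1 : Tendsto (fun τ : ℝ => -(s * ‖d‖) * (‖F (x + τ • d) - c‖ + δ)) (𝓝[>] 0)
        (𝓝 (-(s * ‖d‖) * (δ + δ))) := by
      have h1 := hFd.continuousAt.tendsto.norm
      rw [zero_smul, add_zero, ← hc] at h1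
      exact ((h1.mono_left nhdsWithin_le_nhds).add_const δ).const_mul _
    have hlim2 := (hasDerivAt_iff_tendsto_slope_zero.1 hsq).mono_left
      (nhdsWithin_mono 0 fun τ (hτ : 0 < τ) => hτ.ne')
    simp only [zero_add] at hlim2
    have h5 := le_of_tendsto_of_tendsto hlim1 hlim2 hnear
    rw [zero_smul, add_zero] at h5
    rw [real_inner_smul_left, ← div_eq_inv_mul, le_div_iff₀ hpos]
    linarith

/-! ### Contradiction with the second-order condition -/

/-- The second-order sufficient condition: along every nonzero critical direction, each nonzero
directional multiplier is compensated by a multiplier of the parameter constraints that makes the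
second-order form negative. -/
def SecondOrderCondition {m n l lP : ℕ} (g : Euc m × Euc n → Euc l) (h : Euc m → Euc lP)
    (C : Set (Euc l)) (pbar : Euc m) (xbar : Euc n) : Prop :=
  ∀ (w : Euc m) (u : Euc n) (lam : Euc l), (w, u) ≠ (0, 0) →
    (∀ i, (fderiv ℝ h pbar w) i ≤ 0) →
    fderiv ℝ g (pbar, xbar) (w, u) ∈ contingentCone C (g (pbar, xbar)) →
    lam ≠ 0 →
    lam ∈ directionalNormalCone C (g (pbar, xbar)) (fderiv ℝ g (pbar, xbar) (w, u)) →
    (partialX g pbar xbar).adjoint lam = 0 →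
    ∃ mu : Euc lP, (∀ i, 0 ≤ mu i) ∧
      (partialP g pbar xbar).adjoint lam = (fderiv ℝ h pbar).adjoint mu ∧
      hessianForm (fun z => inner ℝ lam (g z)) (pbar, xbar) (w, u)
        - hessianForm (fun p => inner ℝ mu (h p)) pbar w < 0

/-- The analytic heart: a sequence of approximate multipliers along a direction `(w, u) ≠ 0` yields
a critical multiplier that violates the second-order condition. -/
theorem false_of_approximate_multipliers {m n l lP : ℕ} {g : Euc m × Euc n → Euc l}
    {h : Euc m → Euc lP} {C : Set (Euc l)} {pbar : Euc m} {xbar : Euc n}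
    (hh0 : h pbar = 0) (hg2 : TwiceDifferentiableAt g (pbar, xbar))
    (hh2 : TwiceDifferentiableAt h pbar) (hC : IsFiniteUnionOfConvexPolyhedra C)
    (hsoc : SecondOrderCondition g h C pbar xbar)
    {t s δ : ℕ → ℝ} {w' : ℕ → Euc m} {u' : ℕ → Euc n} {v : ℕ → Euc l} {w : Euc m} {u : Euc n}
    {v₀ : Euc l} (htpos : ∀ k, 0 < t k) (ht : Tendsto t atTop (𝓝 0))
    (hs : Tendsto s atTop (𝓝 0)) (hw : Tendsto w' atTop (𝓝 w)) (hu : Tendsto u' atTop (𝓝 u))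
    (hwu : (w, u) ≠ (0, 0)) (hp : ∀ k i, h (pbar + t k • w' k) i ≤ 0)
    (hδpos : ∀ k, 0 < δ k) (hδ : Tendsto (fun k => δ k / t k) atTop (𝓝 0))
    (hv1 : ∀ k, ‖v k‖ = 1) (hv : Tendsto v atTop (𝓝 v₀))
    (hvC : ∀ k, g (pbar + t k • w' k, xbar + t k • u' k) - δ k • v k ∈ C)
    (hvN : ∀ k, v k ∈ regularNormalCone C
      (g (pbar + t k • w' k, xbar + t k • u' k) - δ k • v k))
    (hcrit : ∀ k d, -(s k * ‖d‖) ≤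
      inner ℝ (v k) (fderiv ℝ g (pbar + t k • w' k, xbar + t k • u' k) (0, d))) : False := by
  set z₀ : Euc m × Euc n := (pbar, xbar) with hz₀
  set G := fderiv ℝ g z₀ with hG
  have hgz : HasFDerivAt g G z₀ := hg2.1.self_of_nhds.hasFDerivAt
  have hhz : HasFDerivAt h (fderiv ℝ h pbar) pbar := hh2.1.self_of_nhds.hasFDerivAt
  have hd : Tendsto (fun k => (w' k, u' k)) atTop (𝓝 (w, u)) := hw.prodMk_nhds hu
  have hzk : ∀ k, (pbar + t k • w' k, xbar + t k • u' k) = z₀ + t k • (w' k, u' k) :=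
    fun k => rfl
  simp only [hzk] at hvC hvN hcrit
  have htd : Tendsto (fun k => t k • (w' k, u' k)) atTop (𝓝 0) := by simpa using ht.smul hd
  have hz : Tendsto (fun k => z₀ + t k • (w' k, u' k)) atTop (𝓝 z₀) := by
    simpa using htd.const_add z₀
  -- first-order behaviour
  have hgdir : Tendsto (fun k => (t k)⁻¹ • (g (z₀ + t k • (w' k, u' k)) - g z₀)) atTop
      (𝓝 (G (w, u))) :=
    tendsto_difference_quotient hgz htpos ht hd
  have hhdir : Tendsto (fun k => (t k)⁻¹ • (h (pbar + t k • w' k) - h pbar)) atTop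
      (𝓝 (fderiv ℝ h pbar w)) :=
    tendsto_difference_quotient hhz htpos ht hw
  have hhw : ∀ i, (fderiv ℝ h pbar w) i ≤ 0 := fun i => by
    have h1 : Tendsto (fun k => ((t k)⁻¹ • (h (pbar + t k • w' k) - h pbar)) i) atTop
        (𝓝 ((fderiv ℝ h pbar w) i)) := by
      have hc : Continuous fun y : Euc lP => y i := by fun_prop
      exact (hc.tendsto _).comp hhdir
    refine le_of_tendsto' h1 fun k => ?_
    rw [hh0, sub_zero]
    exact mul_nonpos_of_nonneg_of_nonpos (inv_nonneg.2 (htpos k).le) (hp k i)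
  -- Rescaled displacement of the projected points. As `δ k = o(t k)`, it has the limit `G (w, u)`,
  -- which gives tangency and the directional normal together.
  let e : ℕ → Euc l := fun k =>
    (t k)⁻¹ • (g (z₀ + t k • (w' k, u' k)) - g z₀) - (δ k / t k) • v k
  have he : Tendsto e atTop (𝓝 (G (w, u))) := by
    simpa [e] using hgdir.sub (hδ.smul hv)
  have hce : ∀ k, g z₀ + t k • e k = g (z₀ + t k • (w' k, u' k)) - δ k • v k := fun k => by
    have h0 := (htpos k).ne'
    simp only [e, smul_sub, smul_smul, mul_inv_cancel₀ h0, one_smul, mul_div_cancel₀ _ h0]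
    abel
  have hct : Tendsto (fun k => g (z₀ + t k • (w' k, u' k)) - δ k • v k) atTop (𝓝 (g z₀)) := by
    simp only [← hce]
    simpa using (ht.smul he).const_add (g z₀)
  have hvunit : ‖v₀‖ = 1 := tendsto_nhds_unique hv.norm (by simp [hv1])
  have hv₀ : v₀ ≠ 0 := fun h0 => by simp [h0] at hvunit
  have htan : G (w, u) ∈ contingentCone C (g z₀) :=
    ⟨t, e, htpos, ht, he, fun k => by rw [hce]; exact hvC k⟩
  have hnor : v₀ ∈ directionalNormalCone C (g z₀) (G (w, u)) :=
    ⟨t, e, v, htpos, ht, he, hv, fun k => by rw [hce]; exact ⟨hvC k, hvN k⟩⟩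
  -- criticality
  have hG0 : ∀ d, inner ℝ v₀ (G (0, d)) = 0 := by
    have hge : ∀ d, 0 ≤ inner ℝ v₀ (G (0, d)) := fun d => by
      have h1 : Tendsto (fun k => fderiv ℝ g (z₀ + t k • (w' k, u' k)) (0, d)) atTop
          (𝓝 (G (0, d))) :=
        ((ContinuousLinearMap.apply ℝ (Euc l) ((0 : Euc m), d)).continuous.tendsto G).comp
          (hg2.2.continuousAt.tendsto.comp hz)
      have h2 : Tendsto (fun k => -(s k * ‖d‖)) atTop (𝓝 0) := by
        simpa using (hs.mul_const ‖d‖).neg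
      exact le_of_tendsto_of_tendsto' h2 (hv.inner h1) fun k => hcrit k d
    intro d
    refine le_antisymm ?_ (hge d)
    have h1 := hge (-d)
    have h2 : ((0 : Euc m), -d) = -(0, d) := by simp
    rw [h2, map_neg, inner_neg_right] at h1
    linarith
  have hpX : ∀ d, partialX g pbar xbar d = G (0, d) := fun d => by
    have h1 := (HasFDerivAt.comp (g := g) (f := fun x => (pbar, x)) xbar hgz
      (hasFDerivAt_prodMk_right pbar xbar)).fderiv
    have h2 : partialX g pbar xbar = G.comp (ContinuousLinearMap.inr ℝ (Euc m) (Euc n)) := h1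
    rw [h2]; rfl
  have hpP : ∀ d, partialP g pbar xbar d = G (d, 0) := fun d => by
    have h1 := (HasFDerivAt.comp (g := g) (f := fun p => (p, xbar)) pbar hgz
      (hasFDerivAt_prodMk_left pbar xbar)).fderiv
    have h2 : partialP g pbar xbar = G.comp (ContinuousLinearMap.inl ℝ (Euc m) (Euc n)) := h1
    rw [h2]; rfl
  have hker : (partialX g pbar xbar).adjoint v₀ = 0 := by
    refine ext_inner_right ℝ fun d => ?_
    rw [ContinuousLinearMap.adjoint_inner_left, hpX, hG0, inner_zero_left]
  obtain ⟨mu, hmu0, hmu, hneg⟩ := hsoc w u v₀ hwu hhw htan hv₀ hnor hker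
  -- second-order expansion
  have hφ := (hg2.inner_left_const v₀).tendsto_taylor htpos ht hd
  have hψ := (hh2.inner_left_const mu).tendsto_taylor htpos ht hw
  have hfirst : ∀ k, fderiv ℝ (fun z => inner ℝ v₀ (g z)) z₀ (t k • (w' k, u' k)) =
      fderiv ℝ (fun p => inner ℝ mu (h p)) pbar (t k • w' k) := fun k => by
    rw [fderiv_inner_left_const hgz.differentiableAt, fderiv_inner_left_const hhz.differentiableAt]
    simp only [ContinuousLinearMap.comp_apply, innerSL_apply_apply]
    have h1 : t k • (w' k, u' k) = (t k • w' k, 0) + (0, t k • u' k) := by simp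
    rw [h1, map_add, inner_add_right, ← hG, hG0, add_zero, ← hpP,
      ← ContinuousLinearMap.adjoint_inner_left, hmu, ContinuousLinearMap.adjoint_inner_left]
  -- Orthogonality turns the increment of `⟨v₀, g⟩` into `δ k * ⟨v₀, v k⟩`, eventually positive
  -- since `v k` tends to the unit vector `v₀`. The `h` term has the favourable sign, and `hfirst`
  -- cancels the linear parts.
  have hfreq : ∃ᶠ k in atTop, 0 ≤
      (inner ℝ v₀ (g (z₀ + t k • (w' k, u' k))) - inner ℝ v₀ (g z₀)
        - fderiv ℝ (fun z => inner ℝ v₀ (g z)) z₀ (t k • (w' k, u' k))) / t k ^ 2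
      - (inner ℝ mu (h (pbar + t k • w' k)) - inner ℝ mu (h pbar)
        - fderiv ℝ (fun p => inner ℝ mu (h p)) pbar (t k • w' k)) / t k ^ 2 := by
    have hvv : ∀ᶠ k in atTop, 0 < inner ℝ v₀ (v k) := by
      have h1 : Tendsto (fun k => inner ℝ v₀ (v k)) atTop (𝓝 (inner ℝ v₀ v₀)) :=
        tendsto_const_nhds.inner hv
      rw [real_inner_self_eq_norm_sq, hvunit] at h1
      exact h1.eventually_const_lt (by norm_num)
    refine ((hC.frequently_inner_eq_zero hvC hct hv hvN).and_eventually hvv).mono ?_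
    rintro k ⟨h1, h2⟩
    rw [← sub_div, hfirst]
    refine div_nonneg ?_ (sq_nonneg _)
    have h3 : inner ℝ mu (h (pbar + t k • w' k)) ≤ 0 := by
      rw [PiLp.inner_apply]
      refine Finset.sum_nonpos fun i _ => ?_
      exact mul_nonpos_of_nonpos_of_nonneg (hp k i) (hmu0 i)
    rw [inner_sub_right, inner_sub_right, inner_smul_right] at h1
    rw [hh0, inner_zero_right]
    nlinarith [mul_pos (hδpos k) h2]
  have hlim := ge_of_tendsto_of_frequently (hφ.sub hψ) hfreq
  linarith

/-! ### Nearby solutions, calmness and Robinson stability -/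

section Solvability

variable {m n l lP : ℕ} {g : Euc m × Euc n → Euc l} {h : Euc m → Euc lP} {C : Set (Euc l)}
  {pbar : Euc m} {xbar : Euc n}

/-- If the residuals of `(p k, x k)` are of smaller order than the distance to the reference point,
then infinitely often there is a solution close to `x k`. -/
theorem frequently_exists_solution_near (hh0 : h pbar = 0) (hfeas : g (pbar, xbar) ∈ C)
    (hg2 : TwiceDifferentiableAt g (pbar, xbar)) (hh2 : TwiceDifferentiableAt h pbar)
    (hC : IsFiniteUnionOfConvexPolyhedra C) (hsoc : SecondOrderCondition g h C pbar xbar)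
    {t s ρ : ℕ → ℝ} {w' : ℕ → Euc m} {u' : ℕ → Euc n} {w : Euc m} {u : Euc n}
    (htpos : ∀ k, 0 < t k) (ht : Tendsto t atTop (𝓝 0))
    (hs0 : ∀ k, 0 ≤ s k) (hs : Tendsto s atTop (𝓝 0))
    (hρ0 : ∀ k, 0 ≤ ρ k) (hρ : Tendsto ρ atTop (𝓝 0))
    (hw : Tendsto w' atTop (𝓝 w)) (hu : Tendsto u' atTop (𝓝 u)) (hwu : (w, u) ≠ (0, 0))
    (hp : ∀ k i, h (pbar + t k • w' k) i ≤ 0)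
    (hsmall : ∀ k, Metric.infDist (g (pbar + t k • w' k, xbar + t k • u' k)) C
      ≤ s k * (ρ k * t k)) :
    ∃ᶠ k in atTop, ∃ x ∈ solutionMap g C (pbar + t k • w' k),
      dist x (xbar + t k • u' k) ≤ ρ k * t k := by
  by_contra hcon
  rw [not_frequently] at hcon
  obtain ⟨ε, hε, hball⟩ := Metric.eventually_nhds_iff_ball.1 hg2.1
  have hpk : Tendsto (fun k => pbar + t k • w' k) atTop (𝓝 pbar) := by
    simpa using (ht.smul hw).const_add pbar
  have hxk : Tendsto (fun k => ρ k * t k + ‖t k • u' k‖) atTop (𝓝 0) := by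
    simpa using (hρ.mul ht).add (ht.smul hu).norm
  have hdiff : ∀ᶠ k in atTop, ∀ x ∈ Metric.closedBall (xbar + t k • u' k) (ρ k * t k),
      DifferentiableAt ℝ g (pbar + t k • w' k, x) := by
    filter_upwards [Metric.tendsto_nhds.1 hpk ε hε, hxk.eventually_lt_const hε] with k h1 h2 x hx
    refine hball _ ?_
    rw [Metric.mem_ball, Prod.dist_eq, max_lt_iff]
    refine ⟨h1, lt_of_le_of_lt ?_ h2⟩
    refine (dist_triangle x (xbar + t k • u' k) xbar).trans (add_le_add hx ?_)
    simp
  obtain ⟨N, hN⟩ := eventually_atTop.1 (hcon.and hdiff)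
  have key : ∀ k, ∃ (x : Euc n) (v : Euc l) (δ : ℝ),
      x ∈ Metric.closedBall (xbar + t (k + N) • u' (k + N)) (ρ (k + N) * t (k + N)) ∧ ‖v‖ = 1 ∧
      0 < δ ∧ δ ≤ s (k + N) * (ρ (k + N) * t (k + N)) ∧
      g (pbar + t (k + N) • w' (k + N), x) - δ • v ∈ C ∧
      v ∈ regularNormalCone C (g (pbar + t (k + N) • w' (k + N), x) - δ • v) ∧
      ∀ d, -(s (k + N) * ‖d‖) ≤
        inner ℝ v (fderiv ℝ g (pbar + t (k + N) • w' (k + N), x) (0, d)) := fun k => by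
    obtain ⟨hno, hdf⟩ := hN (k + N) (Nat.le_add_left N k)
    have hF : ∀ x ∈ Metric.closedBall (xbar + t (k + N) • u' (k + N)) (ρ (k + N) * t (k + N)),
        HasFDerivAt (fun x => g (pbar + t (k + N) • w' (k + N), x))
          ((fderiv ℝ g (pbar + t (k + N) • w' (k + N), x)).comp
            (ContinuousLinearMap.inr ℝ (Euc m) (Euc n))) x := fun x hx =>
      HasFDerivAt.comp (g := g) (f := fun x => (pbar + t (k + N) • w' (k + N), x)) x
        (hdf x hx).hasFDerivAt (hasFDerivAt_prodMk_right _ x)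
    obtain ⟨x, v, δ, hx, h1, h2, h3, h4, h5, h6⟩ :=
      exists_approximate_multiplier (F := fun x => g (pbar + t (k + N) • w' (k + N), x))
        hC.isClosed ⟨_, hfeas⟩ (mul_nonneg (hρ0 (k + N)) (htpos (k + N)).le) (hs0 (k + N))
        (fun x hx => (hF x hx).differentiableAt) (hsmall (k + N))
        (fun x hx hxC => hno ⟨x, hxC, hx⟩)
    refine ⟨x, v, δ, hx, h1, h2, h3, h4, h5, fun d => ?_⟩
    have h7 := h6 d
    rw [(hF x hx).fderiv] at h7
    exact h7
  choose x v δ hx hv1 hδ0 hδ hvC hvN hcrit using key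
  obtain ⟨v₀, -, θ, hθ, hv⟩ := (isCompact_sphere (0 : Euc l) 1).tendsto_subseq
    fun k => mem_sphere_zero_iff_norm.2 (hv1 k)
  have hθN : Tendsto (fun k => θ k + N) atTop atTop :=
    (tendsto_add_atTop_nat N).comp hθ.tendsto_atTop
  have hxu : ∀ k, xbar + t (θ k + N) • ((t (θ k + N))⁻¹ • (x (θ k) - xbar)) = x (θ k) := fun k => by
    rw [smul_smul, mul_inv_cancel₀ (htpos _).ne', one_smul, add_sub_cancel]
  -- The penalized minimizers stay within `ρ * t` of the original points, so after rescaling they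
  -- approach along the same direction `u`.
  have hu'' : Tendsto (fun k => (t (θ k + N))⁻¹ • (x (θ k) - xbar)) atTop (𝓝 u) := by
    have h1 : Tendsto (fun k => (t (θ k + N))⁻¹ • (x (θ k) - xbar) - u' (θ k + N)) atTop
        (𝓝 0) := by
      refine squeeze_zero_norm (fun k => ?_) (hρ.comp hθN)
      have h2 : (t (θ k + N))⁻¹ • (x (θ k) - xbar) - u' (θ k + N) =
          (t (θ k + N))⁻¹ • (x (θ k) - (xbar + t (θ k + N) • u' (θ k + N))) := by
        rw [← sub_sub, smul_sub _ (x (θ k) - xbar), smul_smul, inv_mul_cancel₀ (htpos _).ne',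
          one_smul]
      have h3 := mem_closedBall_iff_norm.1 (hx (θ k))
      rw [h2, norm_smul, norm_inv, Real.norm_eq_abs, abs_of_pos (htpos _), ← div_eq_inv_mul,
        div_le_iff₀ (htpos _)]
      exact h3
    simpa using h1.add (hu.comp hθN)
  refine false_of_approximate_multipliers (t := fun k => t (θ k + N)) (s := fun k => s (θ k + N))
    (δ := fun k => δ (θ k)) (w' := fun k => w' (θ k + N)) (v := fun k => v (θ k)) hh0 hg2 hh2 hC
    hsoc (fun k => htpos _) (ht.comp hθN) (hs.comp hθN) (hw.comp hθN) hu'' hwu (fun k => hp _)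
    (fun k => hδ0 _) ?_ (fun k => hv1 _) hv ?_ ?_ ?_
  · have h1 : Tendsto (fun k => s (θ k + N) * ρ (θ k + N)) atTop (𝓝 0) := by
      simpa using (hs.comp hθN).mul (hρ.comp hθN)
    refine squeeze_zero (fun k => (div_pos (hδ0 _) (htpos _)).le) (fun k => ?_) h1
    rw [div_le_iff₀ (htpos _), mul_assoc]
    exact hδ (θ k)
  all_goals
    intro k
    rw [hxu]
  · exact hvC _
  · exact hvN _
  · exact hcrit _

/-- The solution map is nonempty near `pbar` and has a selection that is calm at `pbar`. -/
theorem exists_calm_solution (hh0 : h pbar = 0) (hfeas : g (pbar, xbar) ∈ C)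
    (hg2 : TwiceDifferentiableAt g (pbar, xbar)) (hh2 : TwiceDifferentiableAt h pbar)
    (hC : IsFiniteUnionOfConvexPolyhedra C) (hsoc : SecondOrderCondition g h C pbar xbar)
    (htan : ∀ w, (∀ i, (fderiv ℝ h pbar w) i ≤ 0) →
      ∃ u, fderiv ℝ g (pbar, xbar) (w, u) ∈ contingentCone C (g (pbar, xbar))) :
    ∃ L : ℝ, 0 ≤ L ∧ ∀ᶠ p in 𝓝 pbar, (∀ i, h p i ≤ 0) →
      ∃ x ∈ solutionMap g C p, dist x xbar ≤ L * dist p pbar := by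
  by_contra! hcon
  have hseq : ∀ k : ℕ, ∃ p, dist p pbar < 1 / (k + 1) ∧ (∀ i, h p i ≤ 0) ∧
      ∀ x ∈ solutionMap g C p, k * dist p pbar < dist x xbar := fun k => by
    have h1 := (hcon k k.cast_nonneg).and_eventually
      (Metric.ball_mem_nhds pbar (Nat.one_div_pos_of_nat (α := ℝ) (n := k)))
    obtain ⟨p, ⟨h2, h3⟩, h4⟩ := h1.exists
    exact ⟨p, h4, h2, h3⟩
  choose p hpdist hp hno using hseq
  have hτ : ∀ k, 0 < ‖p k - pbar‖ := fun k => by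
    rw [norm_pos_iff, sub_ne_zero]
    -- At `pbar` itself `xbar` is a solution at distance zero, so a violating parameter differs from
    -- `pbar`.
    intro heq
    have h1 := hno k xbar (by rw [heq]; exact hfeas)
    rw [heq] at h1
    simp at h1
  have hτ0 : Tendsto (fun k => ‖p k - pbar‖) atTop (𝓝 0) :=
    squeeze_zero (fun k => norm_nonneg _) (fun k => by rw [← dist_eq_norm]; exact (hpdist k).le)
      tendsto_one_div_add_atTop_nhds_zero_nat
  obtain ⟨w, hw1, θ, hθ, hw⟩ := (isCompact_sphere (0 : Euc m) 1).tendsto_subseq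
    (x := fun k => ‖p k - pbar‖⁻¹ • (p k - pbar)) fun k => by
      rw [mem_sphere_zero_iff_norm, norm_smul, norm_inv, norm_norm, inv_mul_cancel₀ (hτ k).ne']
  have hpw : ∀ k, pbar + ‖p (θ k) - pbar‖ • (‖p (θ k) - pbar‖⁻¹ • (p (θ k) - pbar)) = p (θ k) :=
    fun k => by rw [smul_smul, mul_inv_cancel₀ (hτ _).ne', one_smul, add_sub_cancel]
  have hτθ := hτ0.comp hθ.tendsto_atTop
  have hw0 : w ≠ 0 := fun h0 => by simp [h0] at hw1
  have hhw : ∀ i, (fderiv ℝ h pbar w) i ≤ 0 := fun i => by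
    have h1 := tendsto_difference_quotient hh2.1.self_of_nhds.hasFDerivAt (fun k => hτ (θ k))
      hτθ hw
    have hc : Continuous fun y : Euc lP => y i := by fun_prop
    refine le_of_tendsto' ((hc.tendsto _).comp h1) fun k => ?_
    have h2 := hpw k
    simp only [Function.comp_apply]
    rw [h2, hh0, sub_zero]
    exact mul_nonpos_of_nonneg_of_nonpos (inv_nonneg.2 (hτ _).le) (hp _ i)
  obtain ⟨u, hu⟩ := htan w hhw
  set τ : ℕ → ℝ := fun k => ‖p (θ k) - pbar‖ with hτdef
  set w' : ℕ → Euc m := fun k => ‖p (θ k) - pbar‖⁻¹ • (p (θ k) - pbar) with hw'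
  have hτpos : ∀ k, 0 < τ k := fun k => hτ (θ k)
  have hfeasdir : ∀ᶠ k in atTop,
      g (pbar, xbar) + τ k • fderiv ℝ g (pbar, xbar) (w, u) ∈ C :=
    (tendsto_nhdsWithin_iff.2 ⟨hτθ, Eventually.of_forall hτpos⟩).eventually
      (hC.eventually_mem_of_mem_contingentCone hu)
  have hgdir := tendsto_difference_quotient hg2.1.self_of_nhds.hasFDerivAt hτpos hτθ
    (hw.prodMk_nhds (tendsto_const_nhds (x := u)))
  set ε : ℕ → ℝ := fun k => Metric.infDist (g (pbar + τ k • w' k, xbar + τ k • u)) C / τ k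
    with hεdef
  have hε0 : ∀ k, 0 ≤ ε k := fun k => div_nonneg Metric.infDist_nonneg (hτpos k).le
  have hε : Tendsto ε atTop (𝓝 0) := by
    refine squeeze_zero' (Eventually.of_forall hε0) ?_ (tendsto_iff_norm_sub_tendsto_zero.1 hgdir)
    filter_upwards [hfeasdir] with k hk
    rw [hεdef]
    dsimp only
    rw [div_le_iff₀ (hτpos k)]
    refine (Metric.infDist_le_dist_of_mem hk).trans_eq ?_
    have h1 : g (pbar + τ k • w' k, xbar + τ k • u)
        - (g (pbar, xbar) + τ k • fderiv ℝ g (pbar, xbar) (w, u))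
        = τ k • ((τ k)⁻¹ • (g ((pbar, xbar) + τ k • (w' k, u)) - g (pbar, xbar))
          - fderiv ℝ g (pbar, xbar) (w, u)) := by
      have hsplit : ∀ y z d : Euc l, y - (z + τ k • d) = τ k • ((τ k)⁻¹ • (y - z) - d) := by
        intro y z d
        rw [smul_sub (τ k), smul_inv_smul₀ (hτpos k).ne', sub_sub]
      exact hsplit _ _ _
    rw [dist_eq_norm, h1, norm_smul, Real.norm_eq_abs, abs_of_pos (hτpos k), mul_comm]
    rfl
  have hsqrt : Tendsto (fun k => √(ε k)) atTop (𝓝 0) := by simpa using hε.sqrt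
  -- The residual is `ε k * τ k`; splitting `ε k` as `√(ε k) * √(ε k)` makes both the penalty and
  -- the relative radius vanish.
  have hsol := frequently_exists_solution_near (t := τ) (s := fun k => √(ε k))
    (ρ := fun k => √(ε k)) (w' := w') (u' := fun _ => u) hh0 hfeas hg2 hh2 hC hsoc hτpos hτθ
    (fun k => Real.sqrt_nonneg _) hsqrt (fun k => Real.sqrt_nonneg _) hsqrt hw tendsto_const_nhds
    (fun h0 => hw0 (Prod.mk.inj h0).1) (fun k i => by rw [hpw]; exact hp _ i) (fun k => by
      rw [← mul_assoc, Real.mul_self_sqrt (hε0 k), hεdef]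
      dsimp only
      rw [div_mul_cancel₀ _ (hτpos k).ne'])
  -- Once the relative radius is at most one, the solution found lies within `(1 + ‖u‖) * τ k` of
  -- `xbar`.
  have hθlarge : ∀ᶠ k in atTop, 1 + ‖u‖ ≤ (θ k : ℝ) :=
    (tendsto_natCast_atTop_atTop.comp hθ.tendsto_atTop).eventually_ge_atTop _
  obtain ⟨k, ⟨⟨x, hxsol, hx⟩, hρ1⟩, hθk⟩ :=
    ((hsol.and_eventually (hsqrt.eventually_le_const one_pos)).and_eventually hθlarge).exists
  rw [hpw] at hxsol
  have h1 := hno (θ k) x hxsol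
  have h2 : dist (xbar + τ k • u) xbar = τ k * ‖u‖ := by
    rw [dist_self_add_left, norm_smul, Real.norm_eq_abs, abs_of_pos (hτpos k)]
  have h3 := dist_triangle x (xbar + τ k • u) xbar
  rw [dist_eq_norm (p (θ k))] at h1
  change θ k * τ k < _ at h1
  nlinarith [hτpos k]

/-- Robinson stability under the second-order sufficient condition. -/
theorem robinsonStableAt_of_secondOrderCondition (hh0 : h pbar = 0)
    (hfeas : g (pbar, xbar) ∈ C)
    (hg2 : TwiceDifferentiableAt g (pbar, xbar)) (hh2 : TwiceDifferentiableAt h pbar)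
    (hC : IsFiniteUnionOfConvexPolyhedra C) (hsoc : SecondOrderCondition g h C pbar xbar)
    (htan : ∀ w, (∀ i, (fderiv ℝ h pbar w) i ≤ 0) →
      ∃ u, fderiv ℝ g (pbar, xbar) (w, u) ∈ contingentCone C (g (pbar, xbar))) :
    RobinsonStableAt g C {p | ∀ i, h p i ≤ 0} pbar xbar := by
  have hCne : C.Nonempty := ⟨_, hfeas⟩
  obtain ⟨L, hL, hcalm⟩ := exists_calm_solution hh0 hfeas hg2 hh2 hC hsoc htan
  obtain ⟨ε, hε, hcalm⟩ := Metric.eventually_nhds_iff_ball.1 hcalm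
  by_contra hcon
  have hseq : ∀ k : ℕ, ∃ (p : Euc m) (x : Euc n) (y : Euc n), dist p pbar < 1 / (k + 1) ∧
      dist x xbar < 1 / (k + 1) ∧ (∀ i, h p i ≤ 0) ∧ y ∈ solutionMap g C p ∧
      dist y xbar ≤ L * dist p pbar ∧ ∀ x' ∈ solutionMap g C p,
        (k + 1) ^ 2 * Metric.infDist (g (p, x)) C < dist x x' := fun k => by
    have hk : (0 : ℝ) < 1 / (k + 1) := Nat.one_div_pos_of_nat
    by_contra! hno
    refine hcon ⟨((k : ℝ≥0) + 1) ^ 2, Metric.ball pbar (min ε (1 / (k + 1))),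
      Metric.ball_mem_nhds _ (lt_min hε hk), Metric.ball xbar (1 / (k + 1)),
      Metric.ball_mem_nhds _ hk, ?_⟩
    rintro p ⟨hpb, hp⟩ x hx
    rw [Metric.mem_ball, lt_min_iff] at hpb
    obtain ⟨y, hy, hyd⟩ := hcalm p hpb.1 hp
    obtain ⟨x', hx', hle⟩ := hno p x y hpb.2 hx hp hy hyd
    refine (Metric.infEDist_le_edist_of_mem hx').trans ?_
    rw [edist_dist, ← ENNReal.ofReal_toReal (Metric.infEDist_ne_top hCne),
      ← ENNReal.ofReal_coe_nnreal, ← ENNReal.ofReal_mul (NNReal.coe_nonneg _)]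
    refine ENNReal.ofReal_le_ofReal ?_
    push_cast
    exact hle
  choose p x y hpd hxd hp hy hyd hno using hseq
  set δ : ℕ → ℝ := fun k => ‖(p k, x k) - (pbar, xbar)‖ with hδdef
  have hδpos : ∀ k, 0 < δ k := fun k => by
    rw [hδdef, norm_pos_iff, sub_ne_zero]
    intro heq
    obtain ⟨h1, h2⟩ := Prod.mk.inj heq
    have h3 := hno k xbar (by rw [h1]; exact hfeas)
    rw [h1, h2, Metric.infDist_zero_of_mem hfeas] at h3
    simp at h3
  have hpδ : ∀ k, dist (p k) pbar ≤ δ k := fun k => by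
    rw [dist_eq_norm]; exact norm_fst_le ((p k, x k) - (pbar, xbar))
  have hxδ : ∀ k, dist (x k) xbar ≤ δ k := fun k => by
    rw [dist_eq_norm]; exact norm_snd_le ((p k, x k) - (pbar, xbar))
  have hδ0 : Tendsto δ atTop (𝓝 0) :=
    squeeze_zero (fun k => (hδpos k).le) (fun k => by
      change ‖(p k, x k) - (pbar, xbar)‖ ≤ _
      rw [← dist_eq_norm, Prod.dist_eq]
      exact max_le (hpd k).le (hxd k).le) tendsto_one_div_add_atTop_nhds_zero_nat
  obtain ⟨⟨w, u⟩, hwu1, θ, hθ, hwu⟩ := (isCompact_sphere (0 : Euc m × Euc n) 1).tendsto_subseq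
    (x := fun k => (δ k)⁻¹ • ((p k, x k) - (pbar, xbar))) fun k => by
      rw [mem_sphere_zero_iff_norm, norm_smul, norm_inv, Real.norm_eq_abs, abs_of_pos (hδpos k),
        inv_mul_cancel₀ (hδpos k).ne']
  have hwu0 : (w, u) ≠ (0, 0) := fun h0 => by
    rw [h0, mem_sphere_zero_iff_norm] at hwu1
    simp at hwu1
  have hpw : ∀ k, pbar + δ k • ((δ k)⁻¹ • (p k - pbar)) = p k := fun k => by
    rw [smul_smul, mul_inv_cancel₀ (hδpos k).ne', one_smul, add_sub_cancel]
  have hxu : ∀ k, xbar + δ k • ((δ k)⁻¹ • (x k - xbar)) = x k := fun k => by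
    rw [smul_smul, mul_inv_cancel₀ (hδpos k).ne', one_smul, add_sub_cancel]
  -- The violated constant `(k + 1) ^ 2` leaves one factor to spare: the radius `ρ k * δ k` is `k +
  -- 1` times the residual, matched by the penalty `1 / (k + 1)`.
  set ρ : ℕ → ℝ := fun k => (k + 1) * Metric.infDist (g (p k, x k)) C / δ k with hρdef
  have hρ0 : ∀ k, 0 ≤ ρ k := fun k =>
    div_nonneg (mul_nonneg (by positivity) Metric.infDist_nonneg) (hδpos k).le
  have hρδ : ∀ k, ρ k * δ k = (k + 1) * Metric.infDist (g (p k, x k)) C := fun k =>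
    div_mul_cancel₀ _ (hδpos k).ne'
  have hinv : Tendsto (fun k : ℕ => 1 / ((k : ℝ) + 1)) atTop (𝓝 0) :=
    tendsto_one_div_add_atTop_nhds_zero_nat
  have hρ : Tendsto ρ atTop (𝓝 0) := by
    have h1 : Tendsto (fun k : ℕ => (1 + L) * (1 / ((k : ℝ) + 1))) atTop (𝓝 0) := by
      simpa using hinv.const_mul (1 + L)
    refine squeeze_zero hρ0 (fun k => ?_) h1
    have h2 := hno k (y k) (hy k)
    have h3 := dist_triangle_right (x k) (y k) xbar
    have h4 := mul_le_mul_of_nonneg_left (hpδ k) hL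
    have hk : (0 : ℝ) < k + 1 := by positivity
    rw [mul_one_div, div_le_div_iff₀ (hδpos k) hk]
    nlinarith [hxδ k, hyd k]
  have hsol := frequently_exists_solution_near (t := fun k => δ (θ k))
    (s := fun k => 1 / ((θ k : ℝ) + 1)) (ρ := fun k => ρ (θ k))
    (w' := fun k => (δ (θ k))⁻¹ • (p (θ k) - pbar)) (u' := fun k => (δ (θ k))⁻¹ • (x (θ k) - xbar))
    hh0 hfeas hg2 hh2 hC hsoc (fun k => hδpos _) (hδ0.comp hθ.tendsto_atTop)
    (fun k => by positivity) (hinv.comp hθ.tendsto_atTop) (fun k => hρ0 _)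
    (hρ.comp hθ.tendsto_atTop) ((continuous_fst.tendsto _).comp hwu)
    ((continuous_snd.tendsto _).comp hwu) hwu0 (fun k i => by rw [hpw]; exact hp _ i) (fun k => by
      rw [hpw, hxu, hρδ, ← mul_assoc, one_div_mul_cancel (by positivity), one_mul])
  obtain ⟨k, x', hx', hd⟩ := hsol.exists
  rw [hpw] at hx'
  rw [hxu, hρδ, dist_comm] at hd
  have h1 := hno (θ k) x' hx'
  have h2 : (0 : ℝ) ≤ Metric.infDist (g (p (θ k), x (θ k))) C := Metric.infDist_nonneg
  have h3 : (0 : ℝ) ≤ θ k := Nat.cast_nonneg _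
  nlinarith [mul_nonneg h3 h2, mul_nonneg (mul_nonneg h3 h3) h2]

end Solvability

end RobinsonStability

theorem corollary4p4 {m n l lP : ℕ}
    (g : RobinsonStability.Euc m × RobinsonStability.Euc n → RobinsonStability.Euc l)
    (h : RobinsonStability.Euc m → RobinsonStability.Euc lP)
    (C : Set (RobinsonStability.Euc l)) (P : Set (RobinsonStability.Euc m))
    (pbar : RobinsonStability.Euc m) (xbar : RobinsonStability.Euc n)
    (hP : P = {p | ∀ i, h p i ≤ 0})
    (hh0 : h pbar = 0)
    (hfeas : g (pbar, xbar) ∈ C)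
    (hg1 : RobinsonStability.SmoothInDecisionAt g P pbar xbar)
    (hg2 : RobinsonStability.TwiceDifferentiableAt g (pbar, xbar))
    (hh2 : RobinsonStability.TwiceDifferentiableAt h pbar)
    (hC : RobinsonStability.IsFiniteUnionOfConvexPolyhedra C)
    (hsub : RobinsonStability.MetricallySubregularAt
      (RobinsonStability.constraintMapping h (RobinsonStability.nonposOrthant lP)) pbar 0)
    (htan : ∀ w : RobinsonStability.Euc m, (∀ i, (fderiv ℝ h pbar w) i ≤ 0) →
      ∃ u : RobinsonStability.Euc n, fderiv ℝ g (pbar, xbar) (w, u) ∈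
        RobinsonStability.contingentCone C (g (pbar, xbar)))
    (hsoc : ∀ (w : RobinsonStability.Euc m) (u : RobinsonStability.Euc n)
        (lam : RobinsonStability.Euc l),
      (w, u) ≠ (0, 0) →
      (∀ i, (fderiv ℝ h pbar w) i ≤ 0) →
      fderiv ℝ g (pbar, xbar) (w, u) ∈
        RobinsonStability.contingentCone C (g (pbar, xbar)) →
      lam ≠ 0 →
      lam ∈ RobinsonStability.directionalNormalCone C (g (pbar, xbar))
        (fderiv ℝ g (pbar, xbar) (w, u)) →
      (RobinsonStability.partialX g pbar xbar).adjoint lam = 0 →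
      ∃ mu : RobinsonStability.Euc lP, (∀ i, 0 ≤ mu i) ∧
        (RobinsonStability.partialP g pbar xbar).adjoint lam = (fderiv ℝ h pbar).adjoint mu ∧
        RobinsonStability.hessianForm (fun z => inner ℝ lam (g z)) (pbar, xbar) (w, u)
          - RobinsonStability.hessianForm (fun p => inner ℝ mu (h p)) pbar w < 0) :
    RobinsonStability.RobinsonStableAt g C P pbar xbar := by
  subst hP
  exact RobinsonStability.robinsonStableAt_of_secondOrderCondition hh0 hfeas hg2 hh2 hC hsoc htan
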